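/- Let $n\ge 2$, let $\Omega\subset\mathbb{R}^n$ be a non-empty, bounded, open set, and let $\alpha:\Omega\to[0,n)$ be log-Hölder continuous, i.e. there is $c>0$ with $|\alpha(x)-\alpha(y)|\le c/\log(e+1/|x-y|)$ for all $x,y\in\Omega$, $x\ne y$. Suppose that $$0<\alpha^-:=\operatorname*{ess\,inf}_{x\in\Omega}\alpha(x)\le\alpha^+:=\operatorname*{ess\,sup}_{x\in\Omega}\alpha(x)<n .$$ For a measurable $f:\Omega\to\mathbb{R}$ and $x\in\Omega$ let $$I_{\alpha(\cdot)}f(x):=\int_\Omega\frac{|f(y)|}{|x-y|^{n-\alpha(x)}}\,dy\in[0,\infty]$$ be the variable order Riesz potential. With $p(x):=n/\alpha(x)$, let $L^{n/\alpha(\cdot)}(\Omega)$ be the set of measurable $f:\Omega\to\mathbb{R}$ with $\int_\Omega|f(x)|^{p(x)}\,dx<\infty$, with the Luxemburg norm $\|f\|_{L^{n/\alpha(\cdot)}(\Omega)}:=\inf\{\lambda>0:\int_\Omega|f(x)/\lambda|^{p(x)}\,dx\le1\}$. For $E\subset\Omega$ let $$\mathcal{H}_\infty^{n-\alpha(\cdot)}(E):=\inf\Big\{\sum_{i=1}^\infty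 r_i^{\,n-\alpha(x_i)}: x_i\in\Omega,\ r_i>0,\ E\subset\bigcup_{i=1}^\infty B(x_i,r_i)\Big\}$$ be the variable dimensional Hausdorff content, where $B(x,r)$ is the open ball. Then there exist constants $c_1,c_2>0$, independent of $f$ and $t$, such that $$\mathcal{H}_\infty^{n-\alpha(\cdot)}\big(\{x\in\Omega: I_{\alpha(\cdot)}f(x)>t\}\big)\le c_1\exp\Big(-c_2\,t^{\frac{n}{n-\alpha^-}}\Big)$$ for all $t\ge0$ and all $f\in L^{n/\alpha(\cdot)}(\Omega)$ with $\|f\|_{L^{n/\alpha(\cdot)}(\Omega)}\le\frac{1}{2(1+|\Omega|)}$, where $|\Omega|$ is the Lebesgue measure of $\Omega$. -/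

import Mathlib

open MeasureTheory

noncomputable section

namespace VarRiesz

/-- `n`-dimensional Euclidean space. -/
abbrev Space (n : ℕ) : Type := EuclideanSpace ℝ (Fin n)

/-- Log-Hölder continuity of `g` on `U`. -/
def LogHolderOn {n : ℕ} (U : Set (Space n)) (g : Space n → ℝ) : Prop :=
  ∃ c : ℝ, 0 < c ∧ ∀ x ∈ U, ∀ y ∈ U, x ≠ y →
    |g x - g y| ≤ c / Real.log (Real.exp 1 + 1 / dist x y)

/-- `g⁻`, the essential infimum of `g` over `U`. -/
def essInfOn {n : ℕ} (U : Set (Space n)) (g : Space n → ℝ) : ℝ :=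
  essInf g (volume.restrict U)

/-- `g⁺`, the essential supremum of `g` over `U`. -/
def essSupOn {n : ℕ} (U : Set (Space n)) (g : Space n → ℝ) : ℝ :=
  essSup g (volume.restrict U)

/-- The modular `∫_U |f(x)|^{p(x)} dx`, with values in `[0, ∞]`. -/
def modular {n : ℕ} (U : Set (Space n)) (p f : Space n → ℝ) : ENNReal :=
  ∫⁻ x in U, ENNReal.ofReal (|f x| ^ p x)

/-- Membership in `L^{p(·)}(U)`: `f` is Lebesgue measurable on `U` with finite modular. -/
def MemVarLp {n : ℕ} (U : Set (Space n)) (p f : Space n → ℝ) : Prop :=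
  AEStronglyMeasurable f (volume.restrict U) ∧ modular U p f < ⊤

/-- The Luxemburg norm of `L^{p(·)}(U)`. -/
def luxemburgNorm {n : ℕ} (U : Set (Space n)) (p f : Space n → ℝ) : ℝ :=
  sInf {l : ℝ | 0 < l ∧ modular U p (fun x => f x / l) ≤ 1}

/-- The variable order Riesz potential `∫_Ω |f(y)| / |x - y|^{n - α(x)} dy`, with values in
`[0, ∞]`. -/
def rieszPotential {n : ℕ} (Ω : Set (Space n)) (α f : Space n → ℝ) (x : Space n) : ENNReal :=
  ∫⁻ y in Ω, ENNReal.ofReal (|f y| / dist x y ^ ((n : ℝ) - α x))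

/-- The variable dimensional Hausdorff content of `A` for a dimension function `β` that is defined
on `U`: the infimum of `∑ rᵢ ^ β(xᵢ)` over all sequences of open balls `B(xᵢ, rᵢ)` that cover `A`
and have their centres in the domain `U` of `β`. Values of `β` off `U` play no role. -/
def hausdorffContent {n : ℕ} (U : Set (Space n)) (β : Space n → ℝ) (A : Set (Space n)) : ENNReal :=
  ⨅ (x : ℕ → Space n) (r : ℕ → ℝ) (_ : ∀ i, x i ∈ U) (_ : ∀ i, 0 < r i)
    (_ : A ⊆ ⋃ i, Metric.ball (x i) (r i)), ∑' i, ENNReal.ofReal (r i ^ β (x i))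

/-- Admitting more centres, and any extension of the dimension function to them, can only decrease
the content. -/
theorem hausdorffContent_anti {n : ℕ} {U V : Set (Space n)} (hUV : U ⊆ V) {β γ : Space n → ℝ}
    (h : ∀ x ∈ U, γ x = β x) (A : Set (Space n)) :
    hausdorffContent V γ A ≤ hausdorffContent U β A := by
  unfold hausdorffContent
  refine le_iInf fun x => le_iInf fun r => le_iInf fun hx => le_iInf fun hr => le_iInf fun hA => ?_
  refine iInf_le_of_le x (iInf_le_of_le r (iInf_le_of_le (fun i => hUV (hx i))
    (iInf_le_of_le hr (iInf_le_of_le hA ?_))))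
  simp [h _ (hx _)]

end VarRiesz

end

namespace VarRiesz

/-! Put `G = |f|^{n/α(·)}`. The norm bound gives `∫ G ≤ 1`. Fix `x` with potential above `t`, cut
`Ω` into dyadic annuli around `x`, and let `m k` be the integral of `G` over the `k`-th one.
Log-Hölder continuity lets the exponent `α(y)/n` be frozen at `θ = α(x)/n`, and Hölder's inequality
on each annulus bounds its share of the potential by `C₁ q^k + C₂ (m k)^θ` with `q < 1`
(`exists_annulus_bound`).

As `∑ m k ≤ 1`, the first `K` annuli contribute at most a geometric sum plus `C₂ K^{1-θ}`. Take `K`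
of order `t^{1/(1-θ)}`, so that the latter is at most `t/2`. Since the potential exceeds `t`, the
later masses cannot all lie below `ρ^k` (`exists_pow_le_of_lt_tsum`). This yields a ball around `x`
of radius `r = R 2^{-(k+K)}` with mass at least `ρ^k`. For `ρ = 2^{-(n-α⁺)}`, `r^{n-α(x)}` is at
most a constant times `ρ^K ρ^k`, hence times `ρ^K` and the mass of the ball; and `ρ^K` is the
required exponential (`exists_radius_of_lt_rieszPotential`).

A Vitali covering by such balls sums these bounds to the total mass, which is at most 1
(`hausdorffContent_le_of_forall_closedBall`). For small `t`, one ball covering `Ω` suffices. -/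

/-! ### Pointwise bounds on the order, and the modular -/

theorem LogHolderOn.continuousOn {n : ℕ} {U : Set (Space n)} {g : Space n → ℝ}
    (h : LogHolderOn U g) : ContinuousOn g U := by
  obtain ⟨c, hc, h⟩ := h
  rw [Metric.continuousOn_iff]
  intro b hb ε hε
  -- Below this distance `log (1 / dist a b) > c / ε`.
  refine ⟨Real.exp (-(c / ε)), Real.exp_pos _, fun a ha hab => ?_⟩
  rcases eq_or_ne a b with rfl | hne
  · simpa using hε
  have hd : 0 < dist a b := dist_pos.2 hne
  have hlog : c / ε < Real.log (Real.exp 1 + 1 / dist a b) := by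
    rw [Real.lt_log_iff_exp_lt (by positivity)]
    have : Real.exp (c / ε) < 1 / dist a b := by
      rw [lt_div_iff₀ hd, ← lt_div_iff₀' (Real.exp_pos _), one_div, ← Real.exp_neg]
      exact hab
    linarith [Real.exp_pos 1]
  rw [Real.dist_eq]
  refine (h a ha b hb hne).trans_lt ?_
  rw [div_lt_iff₀ ((by positivity : 0 < c / ε).trans hlog)]
  rwa [div_lt_iff₀' hε] at hlog

/-- A closed condition on a continuous function that holds almost everywhere on an open set holds
everywhere on it. -/
theorem mem_of_ae_mem_of_continuousOn {n : ℕ} {U : Set (Space n)} (hU : IsOpen U)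
    {g : Space n → ℝ} (hg : ContinuousOn g U) {S : Set ℝ} (hS : IsClosed S)
    (h : ∀ᵐ x ∂volume.restrict U, g x ∈ S) : ∀ x ∈ U, g x ∈ S := by
  intro x hx
  by_contra hxS
  have hV : IsOpen (U ∩ g ⁻¹' Sᶜ) := hg.isOpen_inter_preimage hU hS.isOpen_compl
  have hpos := hV.measure_pos volume ⟨x, hx, hxS⟩
  rw [ae_restrict_iff' hU.measurableSet, ae_iff] at h
  refine hpos.ne' (measure_mono_null ?_ h)
  rintro y ⟨hy, hyS⟩ hc
  exact hyS (hc hy)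

theorem essInfOn_le {n : ℕ} {U : Set (Space n)} (hU : IsOpen U) {g : Space n → ℝ}
    (hg : ContinuousOn g U) {a : ℝ} (ha : ∀ x ∈ U, a ≤ g x) : ∀ x ∈ U, essInfOn U g ≤ g x := by
  refine mem_of_ae_mem_of_continuousOn hU hg (S := Set.Ici _) isClosed_Ici ?_
  refine ae_essInf_le (f := g) (μ := volume.restrict U) ?_
  exact ⟨a, by simpa using ae_restrict_of_forall_mem hU.measurableSet ha⟩

theorem le_essSupOn {n : ℕ} {U : Set (Space n)} (hU : IsOpen U) {g : Space n → ℝ}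
    (hg : ContinuousOn g U) {b : ℝ} (hb : ∀ x ∈ U, g x ≤ b) : ∀ x ∈ U, g x ≤ essSupOn U g := by
  refine mem_of_ae_mem_of_continuousOn hU hg (S := Set.Iic _) isClosed_Iic ?_
  refine ae_le_essSup (f := g) (μ := volume.restrict U) ?_
  exact ⟨b, by simpa using ae_restrict_of_forall_mem hU.measurableSet hb⟩

/-- Over the zero measure the essential infimum is `sSup` of all of `ℝ`, with default value 0. A
positive `α⁻` therefore forces `Ω` to be non-empty. -/
theorem essInfOn_empty {n : ℕ} (g : Space n → ℝ) : essInfOn ∅ g = 0 := by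
  simp [essInfOn, essInf, Filter.liminf, Filter.limsInf]

/-- The Luxemburg norm controls the modular on the open unit ball. -/
theorem modular_le_one {n : ℕ} {U : Set (Space n)} (hU : MeasurableSet U) {p f : Space n → ℝ}
    (hp : ∀ x ∈ U, 1 ≤ p x) (hf : modular U p f < ⊤) (hnorm : luxemburgNorm U p f < 1) :
    modular U p f ≤ 1 := by
  -- Non-emptiness excludes the default value `sInf ∅ = 0`. Since `p ≥ 1`, dividing `f` by `1 + m ≥
  -- 1` divides the modular by at least `1 + m`.
  have hne : {l : ℝ | 0 < l ∧ modular U p (fun x => f x / l) ≤ 1}.Nonempty := by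
    set m := (modular U p f).toReal with hm
    have hm0 : 0 ≤ m := ENNReal.toReal_nonneg
    refine ⟨1 + m, by positivity, ?_⟩
    have key : ∀ x ∈ U, ENNReal.ofReal (|f x / (1 + m)| ^ p x) ≤
        ENNReal.ofReal (1 + m)⁻¹ * ENNReal.ofReal (|f x| ^ p x) := by
      intro x hx
      rw [← ENNReal.ofReal_mul (by positivity)]
      refine ENNReal.ofReal_le_ofReal ?_
      rw [abs_div, abs_of_pos (by positivity : 0 < 1 + m), div_eq_inv_mul,
        Real.mul_rpow (by positivity) (abs_nonneg _)]
      refine mul_le_mul_of_nonneg_right ?_ (by positivity)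
      conv_rhs => rw [← Real.rpow_one (1 + m)⁻¹]
      exact Real.rpow_le_rpow_of_exponent_ge (by positivity)
        (inv_le_one_of_one_le₀ (by linarith)) (hp x hx)
    calc modular U p (fun x => f x / (1 + m))
        ≤ ∫⁻ x in U, ENNReal.ofReal (1 + m)⁻¹ * ENNReal.ofReal (|f x| ^ p x) :=
          setLIntegral_mono' hU key
      _ = ENNReal.ofReal (1 + m)⁻¹ * modular U p f :=
          lintegral_const_mul' _ _ ENNReal.ofReal_ne_top
      _ = ENNReal.ofReal ((1 + m)⁻¹ * m) := by
          rw [ENNReal.ofReal_mul (by positivity), hm, ENNReal.ofReal_toReal hf.ne]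
      _ ≤ 1 := by
          rw [ENNReal.ofReal_le_one, inv_mul_le_one₀ (by positivity)]
          linarith
  obtain ⟨l, ⟨hl, hl1⟩, hlt⟩ := exists_lt_of_csInf_lt hne hnorm
  refine le_trans (setLIntegral_mono' hU fun x hx => ENNReal.ofReal_le_ofReal ?_) hl1
  refine Real.rpow_le_rpow (abs_nonneg _) ?_ (by linarith [hp x hx])
  rw [abs_div, abs_of_pos hl, le_div_iff₀ hl]
  exact mul_le_of_le_one_right (abs_nonneg _) hlt.le

/-! ### Coverings and the content -/

/-- Any countable cover by balls with centres in `U` bounds the content. -/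
theorem hausdorffContent_le_tsum {n : ℕ} {U : Set (Space n)} {β : Space n → ℝ}
    {A : Set (Space n)} {x₀ : Space n} (hx₀ : x₀ ∈ U) (hβ : 0 < β x₀) {ι : Type*} [Countable ι]
    (x : ι → Space n) (r : ι → ℝ) (hx : ∀ i, x i ∈ U) (hr : ∀ i, 0 < r i)
    (hA : A ⊆ ⋃ i, Metric.ball (x i) (r i)) :
    hausdorffContent U β A ≤ ∑' i, ENNReal.ofReal (r i ^ β (x i)) := by
  refine ENNReal.le_of_forall_pos_le_add fun ε hε _ => ?_
  obtain ⟨e, he, hsum⟩ := ENNReal.exists_pos_sum_of_countable (ENNReal.coe_ne_zero.2 hε.ne') ℕ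
  obtain ⟨φ, hφ⟩ := exists_injective_nat ι
  -- The content demands a full sequence of balls of positive radius. Unused indices get balls at
  -- `x₀` whose contributions are exactly `e k`, of total below `ε`.
  set y : ℕ → Space n := Function.extend φ x fun _ => x₀ with hy
  set ρ : ℕ → ℝ := Function.extend φ r fun k => (e k : ℝ) ^ (β x₀)⁻¹ with hρ
  have hyi : ∀ i, y (φ i) = x i := fun i => hφ.extend_apply _ _ _
  have hρi : ∀ i, ρ (φ i) = r i := fun i => hφ.extend_apply _ _ _
  have hyk : ∀ k, (¬∃ i, φ i = k) → y k = x₀ := fun k hk => Function.extend_apply' _ _ _ hk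
  have hρk : ∀ k, (¬∃ i, φ i = k) → ρ k = (e k : ℝ) ^ (β x₀)⁻¹ :=
    fun k hk => Function.extend_apply' _ _ _ hk
  have hyU : ∀ k, y k ∈ U := by
    intro k
    by_cases hk : ∃ i, φ i = k
    · obtain ⟨i, rfl⟩ := hk
      rw [hyi]; exact hx i
    · rwa [hyk k hk]
  have hρpos : ∀ k, 0 < ρ k := by
    intro k
    by_cases hk : ∃ i, φ i = k
    · obtain ⟨i, rfl⟩ := hk
      rw [hρi]; exact hr i
    · rw [hρk k hk]; exact Real.rpow_pos_of_pos (by exact_mod_cast he k) _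
  have hcov : A ⊆ ⋃ k, Metric.ball (y k) (ρ k) := by
    refine hA.trans (Set.iUnion_subset fun i => ?_)
    rw [← hyi, ← hρi]
    exact Set.subset_iUnion (fun k => Metric.ball (y k) (ρ k)) (φ i)
  have hterm : ∀ k, ENNReal.ofReal (ρ k ^ β (y k)) ≤
      Function.extend φ (fun i => ENNReal.ofReal (r i ^ β (x i))) 0 k + (e k : ENNReal) := by
    intro k
    by_cases hk : ∃ i, φ i = k
    · obtain ⟨i, rfl⟩ := hk
      rw [hyi, hρi, hφ.extend_apply]
      exact le_self_add
    · rw [hyk k hk, hρk k hk, ← Real.rpow_mul (by positivity), inv_mul_cancel₀ hβ.ne',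
        Real.rpow_one, ENNReal.ofReal_coe_nnreal]
      exact le_add_self
  calc hausdorffContent U β A ≤ ∑' k, ENNReal.ofReal (ρ k ^ β (y k)) :=
        iInf_le_of_le y (iInf_le_of_le ρ (iInf_le_of_le hyU (iInf_le_of_le hρpos
          (iInf_le_of_le hcov le_rfl))))
    _ ≤ ∑' k, (Function.extend φ (fun i => ENNReal.ofReal (r i ^ β (x i))) 0 k +
          (e k : ENNReal)) := ENNReal.tsum_le_tsum hterm
    _ = ∑' i, ENNReal.ofReal (r i ^ β (x i)) + ∑' k, (e k : ENNReal) := by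
        rw [ENNReal.tsum_add, tsum_extend_zero hφ]
    _ ≤ _ := by gcongr

/-- If every point of `A` is the centre of a ball whose contribution to the content is dominated by
its `μ`-mass, then the content of `A` is dominated by the total mass of `μ`. -/
theorem hausdorffContent_le_of_forall_closedBall {n : ℕ} {U : Set (Space n)} {β : Space n → ℝ}
    {A : Set (Space n)} {x₀ : Space n} (hx₀ : x₀ ∈ U) (hβx₀ : 0 < β x₀) (hAU : A ⊆ U)
    (hβ : ∀ x ∈ U, β x ≤ n) (μ : Measure (Space n)) {ε : ENNReal} {R : ℝ}
    (h : ∀ x ∈ A, ∃ r : ℝ, 0 < r ∧ r ≤ R ∧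
      ENNReal.ofReal (r ^ β x) ≤ ε * μ (Metric.closedBall x r)) :
    hausdorffContent U β A ≤ 6 ^ n * (ε * μ Set.univ) := by
  choose! r hr hrR hrμ using h
  obtain ⟨u, huA, hdisj, hcov⟩ :=
    Vitali.exists_disjoint_subfamily_covering_enlargement_closedBall A id r R hrR 5 (by norm_num)
  simp only [id] at hdisj hcov
  have hcount : u.Countable := hdisj.countable_of_nonempty_interior fun x hx =>
    ⟨x, Metric.ball_subset_interior_closedBall (Metric.mem_ball_self (hr x (huA hx)))⟩
  have := hcount.to_subtype
  -- Vitali gives closed balls enlarged by 5; the factor 6 makes them open. It costs `6 ^ β ≤ 6 ^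
  -- n`.
  have hsub : A ⊆ ⋃ i : u, Metric.ball (i : Space n) (6 * r i) := by
    intro x hx
    obtain ⟨b, hb, hxb⟩ := hcov x hx
    refine Set.mem_iUnion.2 ⟨⟨b, hb⟩, ?_⟩
    refine Metric.closedBall_subset_ball ?_ (hxb (Metric.mem_closedBall_self (hr x hx).le))
    show 5 * r b < 6 * r b
    linarith [hr b (huA hb)]
  calc hausdorffContent U β A ≤ ∑' i : u, ENNReal.ofReal ((6 * r i) ^ β i) :=
        hausdorffContent_le_tsum hx₀ hβx₀ _ _ (fun i => hAU (huA i.2))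
          (fun i => by have := hr i (huA i.2); positivity) hsub
    _ ≤ ∑' i : u, 6 ^ n * (ε * μ (Metric.closedBall i (r i))) := by
        refine ENNReal.tsum_le_tsum fun i => ?_
        rw [Real.mul_rpow (by norm_num) (hr i (huA i.2)).le, ENNReal.ofReal_mul (by positivity)]
        refine mul_le_mul' ?_ (hrμ i (huA i.2))
        have h6 : (6 : ENNReal) ^ n = ENNReal.ofReal ((6 : ℝ) ^ n) := by
          rw [ENNReal.ofReal_pow (by norm_num)]; norm_num
        rw [h6]
        refine ENNReal.ofReal_le_ofReal ?_
        rw [← Real.rpow_natCast]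
        exact Real.rpow_le_rpow_of_exponent_le (by norm_num) (hβ i (hAU (huA i.2)))
    _ = 6 ^ n * (ε * ∑' i : u, μ (Metric.closedBall i (r i))) := by
        rw [ENNReal.tsum_mul_left, ENNReal.tsum_mul_left]
    _ ≤ _ := by
        gcongr
        refine (tsum_meas_le_meas_iUnion_of_disjoint μ
          (fun i => Metric.isClosed_closedBall.measurableSet) ?_).trans
          (measure_mono (Set.subset_univ _))
        intro i j hij
        exact hdisj i.2 j.2 (fun h => hij (Subtype.ext h))

/-! ### Freezing the exponent, and sequences of masses -/

/-- The three terms answer three sizes of `G`. If `G ≤ 1`, then `G ^ θ ≤ 1`. If `1 < G ≤ s ^ (-M)`,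
changing the exponent to `θ₀` costs at most `s ^ (-M|θ - θ₀|) ≤ exp (M L)`. If `G > s ^ (-M)`, then
`G ^ (θ - 1) ≤ s ^ (M(1 - θ)) ≤ s ^ d`. -/
theorem rpow_le_one_add_add {G s θ θ₀ M L d : ℝ} (hG : 0 ≤ G) (hs : 0 < s) (hs1 : s ≤ 1)
    (hM : 0 ≤ M) (hθ : 0 ≤ θ) (hθ1 : θ ≤ 1) (hd : d ≤ M * (1 - θ))
    (hL : |θ - θ₀| * -Real.log s ≤ L) :
    G ^ θ ≤ 1 + Real.exp (M * L) * G ^ θ₀ + s ^ d * G := by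
  have hlog : Real.log s ≤ 0 := Real.log_nonpos hs.le hs1
  have h2 : 0 ≤ Real.exp (M * L) * G ^ θ₀ := by positivity
  have h3 : 0 ≤ s ^ d * G := by positivity
  rcases le_or_gt G 1 with hG1 | hG1
  · linarith [Real.rpow_le_one hG hG1 hθ]
  have hG0 : 0 < G := by linarith
  have hlG : 0 ≤ Real.log G := Real.log_nonneg hG1.le
  rcases le_or_gt (Real.log G) (M * -Real.log s) with hcase | hcase
  · have : G ^ θ ≤ Real.exp (M * L) * G ^ θ₀ := by
      rw [Real.rpow_def_of_pos hG0, Real.rpow_def_of_pos hG0, ← Real.exp_add, Real.exp_le_exp]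
      have h4 : Real.log G * (θ - θ₀) ≤ Real.log G * |θ - θ₀| :=
        mul_le_mul_of_nonneg_left (le_abs_self _) hlG
      have h5 : Real.log G * |θ - θ₀| ≤ M * -Real.log s * |θ - θ₀| :=
        mul_le_mul_of_nonneg_right hcase (abs_nonneg _)
      have h6 := mul_le_mul_of_nonneg_left hL hM
      linarith
    linarith
  · have : G ^ θ ≤ s ^ d * G := by
      nth_rewrite 2 [← Real.exp_log hG0]
      rw [Real.rpow_def_of_pos hG0, Real.rpow_def_of_pos hs, ← Real.exp_add, Real.exp_le_exp]
      have h4 : 0 ≤ (1 - θ) * (Real.log G - M * -Real.log s) :=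
        mul_nonneg (by linarith) (by linarith)
      have h5 := mul_le_mul_of_nonneg_right hd (neg_nonneg.2 hlog)
      linarith
    linarith

theorem lintegral_rpow_le {X : Type*} [MeasurableSpace X] {μ : Measure X} {g : X → ENNReal}
    (hg : AEMeasurable g μ) {θ : ℝ} (hθ : 0 ≤ θ) (hθ1 : θ ≤ 1) :
    ∫⁻ x, g x ^ θ ∂μ ≤ (∫⁻ x, g x ∂μ) ^ θ * μ Set.univ ^ (1 - θ) := by
  simpa using ENNReal.lintegral_mul_norm_pow_le hg (aemeasurable_const (b := (1 : ENNReal))) hθ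
    (by linarith : 0 ≤ 1 - θ) (by ring)

/-- Hölder's inequality for `K` terms: this loss `K ^ (1 - θ)` is the source of the exponent of `t`
in the theorem. -/
theorem sum_range_rpow_le {m : ℕ → ENNReal} (hm : ∑' k, m k ≤ 1) {θ : ℝ} (hθ : 0 < θ)
    (hθ1 : θ ≤ 1) (K : ℕ) : ∑ k ∈ Finset.range K, m k ^ θ ≤ (K : ENNReal) ^ (1 - θ) := by
  have h := ENNReal.rpow_sum_le_const_mul_sum_rpow (Finset.range K) (fun k => m k ^ θ)
    (p := θ⁻¹) ((one_le_inv₀ hθ).2 hθ1)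
  have h1 : ∑ k ∈ Finset.range K, (m k ^ θ) ^ θ⁻¹ ≤ 1 := by
    simp_rw [ENNReal.rpow_rpow_inv hθ.ne']
    exact (ENNReal.sum_le_tsum _).trans hm
  rw [Finset.card_range] at h
  have h2 := ENNReal.rpow_le_rpow (h.trans (mul_le_of_le_one_right' h1)) hθ.le
  rwa [ENNReal.rpow_inv_rpow hθ.ne', ← ENNReal.rpow_mul, sub_mul, inv_mul_cancel₀ hθ.ne',
    one_mul] at h2

theorem tsum_ofReal_mul_geometric {C q : ℝ} (hC : 0 ≤ C) (hq : 0 ≤ q) (hq1 : q < 1) :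
    ∑' k : ℕ, ENNReal.ofReal (C * q ^ k) = ENNReal.ofReal (C / (1 - q)) := by
  rw [← ENNReal.ofReal_tsum_of_nonneg (fun k => by positivity)
    ((summable_geometric_of_lt_one hq hq1).mul_left C), tsum_mul_left,
    tsum_geometric_of_lt_one hq hq1, div_eq_mul_inv]

/-- If `∑ aₖ` is large while `aₖ ≲ qᵏ + mₖ ^ θ` with `∑ mₖ ≤ 1`, then some late `mₖ` cannot decay
geometrically. -/
theorem exists_pow_le_of_lt_tsum {m a : ℕ → ENNReal} {q ρ θ θ₀ C₁ C₂ t : ℝ} {K : ℕ}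
    (hm : ∑' k, m k ≤ 1) (hC₁ : 0 ≤ C₁) (hC₂ : 0 ≤ C₂) (hq : 0 ≤ q) (hq1 : q < 1) (hρ : 0 < ρ)
    (hρ1 : ρ < 1) (hθ₀ : 0 < θ₀) (hθ : θ₀ ≤ θ) (hθ1 : θ ≤ 1)
    (ha : ∀ k, a k ≤ ENNReal.ofReal (C₁ * q ^ k) + ENNReal.ofReal C₂ * m k ^ θ)
    (ht : C₁ / (1 - q) + C₂ / (1 - ρ ^ θ₀) ≤ t / 2) (hK : C₂ * (K : ℝ) ^ (1 - θ) ≤ t / 2)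
    (hta : ENNReal.ofReal t < ∑' k, a k) :
    ∃ k, ENNReal.ofReal (ρ ^ k) ≤ m (k + K) := by
  by_contra! hcon
  have hθp : 0 < θ := hθ₀.trans_le hθ
  have hσ0 : 0 ≤ ρ ^ θ₀ := by positivity
  have hσ1 : ρ ^ θ₀ < 1 := Real.rpow_lt_one hρ.le hρ1 hθ₀
  -- Comparing with `θ₀ ≤ θ` keeps the geometric constant uniform in `θ`, which will depend on the
  -- point `x`.
  have htail : ∀ k, m (k + K) ^ θ ≤ ENNReal.ofReal (1 * (ρ ^ θ₀) ^ k) := by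
    intro k
    calc m (k + K) ^ θ ≤ ENNReal.ofReal (ρ ^ k) ^ θ := ENNReal.rpow_le_rpow (hcon k).le hθp.le
      _ = ENNReal.ofReal ((ρ ^ k) ^ θ) := ENNReal.ofReal_rpow_of_pos (by positivity)
      _ ≤ _ := by
        refine ENNReal.ofReal_le_ofReal ?_
        rw [one_mul, ← Real.rpow_natCast, ← Real.rpow_natCast, ← Real.rpow_mul hρ.le,
          ← Real.rpow_mul hρ.le, mul_comm θ₀]
        exact Real.rpow_le_rpow_of_exponent_ge hρ hρ1.le (by gcongr)
  have hsum : ∑' k, m k ^ θ ≤ ENNReal.ofReal ((K : ℝ) ^ (1 - θ) + 1 / (1 - ρ ^ θ₀)) := by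
    have hsplit : ∑' k, m k ^ θ = ∑ k ∈ Finset.range K, m k ^ θ + ∑' k, m (k + K) ^ θ :=
      (Summable.sum_add_tsum_nat_add' (f := fun k => m k ^ θ) (k := K) ENNReal.summable).symm
    rw [hsplit,
      ENNReal.ofReal_add (by positivity) (div_nonneg zero_le_one (by linarith)),
      ← tsum_ofReal_mul_geometric zero_le_one hσ0 hσ1]
    refine add_le_add ((sum_range_rpow_le hm hθp hθ1 K).trans_eq ?_)
      (ENNReal.tsum_le_tsum htail)
    rw [← ENNReal.ofReal_rpow_of_nonneg (by positivity) (by linarith), ENNReal.ofReal_natCast]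
  have hbound : ∑' k, a k ≤ ENNReal.ofReal t := by
    calc ∑' k, a k ≤ ∑' k, (ENNReal.ofReal (C₁ * q ^ k) + ENNReal.ofReal C₂ * m k ^ θ) :=
          ENNReal.tsum_le_tsum ha
      _ = ENNReal.ofReal (C₁ / (1 - q)) + ENNReal.ofReal C₂ * ∑' k, m k ^ θ := by
          rw [ENNReal.tsum_add, tsum_ofReal_mul_geometric hC₁ hq hq1, ENNReal.tsum_mul_left]
      _ ≤ ENNReal.ofReal (C₁ / (1 - q)) +
          ENNReal.ofReal C₂ * ENNReal.ofReal ((K : ℝ) ^ (1 - θ) + 1 / (1 - ρ ^ θ₀)) := by gcongr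
      _ = ENNReal.ofReal (C₁ / (1 - q) + C₂ * ((K : ℝ) ^ (1 - θ) + 1 / (1 - ρ ^ θ₀))) := by
          have : 0 ≤ 1 / (1 - ρ ^ θ₀) := div_nonneg zero_le_one (by linarith)
          rw [← ENNReal.ofReal_mul hC₂, ← ENNReal.ofReal_add
            (div_nonneg hC₁ (by linarith)) (by positivity)]
      _ ≤ _ := by
          refine ENNReal.ofReal_le_ofReal ?_
          rw [mul_add, mul_one_div]
          linarith
  exact absurd hta (not_lt.2 hbound)

/-! ### Dyadic annuli -/

/-- The measure on `U` whose total mass is the modular of `f`. -/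
noncomputable def modularMeasure {n : ℕ} (U : Set (Space n)) (p f : Space n → ℝ) :
    Measure (Space n) :=
  (volume.restrict U).withDensity fun y => ENNReal.ofReal (|f y| ^ p y)

theorem modularMeasure_univ {n : ℕ} (U : Set (Space n)) (p f : Space n → ℝ) :
    modularMeasure U p f Set.univ = modular U p f := by
  simp [modularMeasure, modular]

theorem modularMeasure_apply {n : ℕ} {U A : Set (Space n)} (p f : Space n → ℝ)
    (hA : MeasurableSet A) (hAU : A ⊆ U) :
    modularMeasure U p f A = ∫⁻ y in A, ENNReal.ofReal (|f y| ^ p y) := by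
  rw [modularMeasure, withDensity_apply _ hA, Measure.restrict_restrict hA,
    Set.inter_eq_left.2 hAU]

/-- The part of `U` at distance between `R 2⁻ᵏ⁻¹` and `R 2⁻ᵏ` from `x`. -/
def dyadicAnnulus {n : ℕ} (U : Set (Space n)) (x : Space n) (R : ℝ) (k : ℕ) : Set (Space n) :=
  {y ∈ U | R * (1 / 2) ^ (k + 1) < dist x y ∧ dist x y ≤ R * (1 / 2) ^ k}

section dyadicAnnulus

variable {n : ℕ} {U : Set (Space n)} {x : Space n} {R : ℝ}

theorem dyadicAnnulus_subset (k : ℕ) : dyadicAnnulus U x R k ⊆ U := fun _ hy => hy.1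

theorem dyadicAnnulus_subset_closedBall (k : ℕ) :
    dyadicAnnulus U x R k ⊆ Metric.closedBall x (R * (1 / 2) ^ k) := fun y hy => by
  rw [Metric.mem_closedBall']; exact hy.2.2

theorem measurableSet_dyadicAnnulus (hU : MeasurableSet U) (k : ℕ) :
    MeasurableSet (dyadicAnnulus U x R k) :=
  have hd : Measurable fun y => dist x y := by fun_prop
  hU.inter ((measurableSet_lt measurable_const hd).inter (measurableSet_le hd measurable_const))

theorem pairwise_disjoint_dyadicAnnulus (hR : 0 ≤ R) :
    Pairwise (Function.onFun Disjoint (dyadicAnnulus U x R)) := by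
  have key : ∀ i j, i < j → Disjoint (dyadicAnnulus U x R i) (dyadicAnnulus U x R j) := by
    intro i j hij
    refine Set.disjoint_left.2 fun y hi hj => ?_
    have : R * (1 / 2 : ℝ) ^ j ≤ R * (1 / 2) ^ (i + 1) :=
      mul_le_mul_of_nonneg_left
        (pow_le_pow_of_le_one (by norm_num) (by norm_num) (Nat.succ_le_of_lt hij)) hR
    linarith [hi.2.1, hj.2.2]
  intro i j hij
  rcases lt_or_gt_of_ne hij with h | h
  · exact key i j h
  · exact (key j i h).symm

theorem subset_iUnion_dyadicAnnulus (hR : 0 < R) (h : ∀ y ∈ U, dist x y ≤ R) :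
    U ⊆ (⋃ k, dyadicAnnulus U x R k) ∪ {x} := by
  intro y hy
  rcases eq_or_ne x y with rfl | hne
  · exact Or.inr rfl
  have hd : 0 < dist x y := dist_pos.2 hne
  obtain ⟨k, hk1, hk2⟩ := exists_nat_pow_near_of_lt_one (x := dist x y / R) (y := (1 / 2 : ℝ))
    (by positivity) ((div_le_one hR).2 (h y hy)) (by norm_num) (by norm_num)
  rw [lt_div_iff₀' hR] at hk1
  rw [div_le_iff₀' hR] at hk2
  exact Or.inl (Set.mem_iUnion.2 ⟨k, hy, hk1, hk2⟩)

end dyadicAnnulus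

theorem rieszPotential_le_tsum {n : ℕ} {Ω : Set (Space n)} {α f : Space n → ℝ} {x : Space n}
    {R : ℝ} (hR : 0 < R) (h : ∀ y ∈ Ω, dist x y ≤ R) (hα : α x < n) :
    rieszPotential Ω α f x ≤
      ∑' k, ∫⁻ y in dyadicAnnulus Ω x R k, ENNReal.ofReal (|f y| / dist x y ^ ((n : ℝ) - α x)) := by
  have hpt : ∫⁻ y in {x}, ENNReal.ofReal (|f y| / dist x y ^ ((n : ℝ) - α x)) = 0 := by
    -- At the centre the integrand is a division by zero, hence 0.
    rw [lintegral_singleton, dist_self, Real.zero_rpow (by linarith)]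
    simp
  calc rieszPotential Ω α f x
      ≤ ∫⁻ y in (⋃ k, dyadicAnnulus Ω x R k) ∪ {x},
          ENNReal.ofReal (|f y| / dist x y ^ ((n : ℝ) - α x)) :=
        lintegral_mono_set (subset_iUnion_dyadicAnnulus hR h)
    _ ≤ (∫⁻ y in ⋃ k, dyadicAnnulus Ω x R k,
          ENNReal.ofReal (|f y| / dist x y ^ ((n : ℝ) - α x))) + 0 := by
        rw [← hpt]; exact lintegral_union_le _ _ _
    _ ≤ _ := by rw [add_zero]; exact lintegral_iUnion_le _ _

/-! ### Contribution of one annulus -/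

/-- The kernel is at most `D`, of size `(R s) ^ (b - n)`. The terms `1` and `s ^ n * G` of `hf` thus
contribute at most a multiple of `s ^ b ≤ s ^ a`. For the middle term, Hölder produces the volume to
the power `1 - b / n`, of size `(R s) ^ (n - b)`, which cancels the kernel and leaves a constant. -/
theorem lintegral_div_dist_rpow_le {n : ℕ} {A : Set (Space n)} (hA : MeasurableSet A)
    {f G : Space n → ℝ} (hG : ∀ y, 0 ≤ G y)
    (hGm : AEMeasurable (fun y => ENNReal.ofReal (G y)) (volume.restrict A))
    {x : Space n} {R s E V a b : ℝ} (hR : 1 ≤ R) (hs : 0 < s) (hs1 : s ≤ 1) (hE : 0 ≤ E)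
    (hV : 0 ≤ V) (ha : 0 < a) (hab : a ≤ b) (hbn : b < n)
    (hvol : volume A ≤ ENNReal.ofReal (V * (R * s) ^ (n : ℝ)))
    (hdist : ∀ y ∈ A, R * s / 2 ≤ dist x y)
    (hf : ∀ y ∈ A, |f y| ≤ 1 + E * G y ^ (b / n) + s ^ (n : ℝ) * G y)
    (hmass : ∫⁻ y in A, ENNReal.ofReal (G y) ≤ 1) :
    ∫⁻ y in A, ENNReal.ofReal (|f y| / dist x y ^ ((n : ℝ) - b)) ≤
      ENNReal.ofReal (2 ^ (n : ℝ) * (V * R ^ (n : ℝ) + 1) * s ^ a) +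
        ENNReal.ofReal (2 ^ (n : ℝ) * E * (1 + V)) *
          (∫⁻ y in A, ENNReal.ofReal (G y)) ^ (b / n) := by
  have hb : 0 < b := ha.trans_le hab
  have hn : (0 : ℝ) < n := hb.trans hbn
  have hθ : 0 < b / n := by positivity
  have hθ1 : b / n ≤ 1 := (div_le_one hn).2 hbn.le
  have hR0 : 0 < R := by linarith
  have hr : 0 < R * s := by positivity
  set D : ℝ := 2 ^ (n : ℝ) * (R * s) ^ (b - n) with hD
  have hD0 : 0 ≤ D := by positivity
  set m := ∫⁻ y in A, ENNReal.ofReal (G y) with hm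
  have hptw : ∀ y ∈ A, ENNReal.ofReal (|f y| / dist x y ^ ((n : ℝ) - b)) ≤
      ENNReal.ofReal D * (1 + ENNReal.ofReal E * ENNReal.ofReal (G y) ^ (b / n) +
        ENNReal.ofReal (s ^ (n : ℝ)) * ENNReal.ofReal (G y)) := by
    intro y hy
    rw [ENNReal.ofReal_rpow_of_nonneg (hG y) hθ.le, ← ENNReal.ofReal_mul hE,
      ← ENNReal.ofReal_mul (by positivity), ← ENNReal.ofReal_one,
      ← ENNReal.ofReal_add zero_le_one (mul_nonneg hE (Real.rpow_nonneg (hG y) _)),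
      ← ENNReal.ofReal_add (add_nonneg zero_le_one (mul_nonneg hE (Real.rpow_nonneg (hG y) _)))
        (mul_nonneg (by positivity) (hG y)), ← ENNReal.ofReal_mul hD0]
    refine ENNReal.ofReal_le_ofReal ?_
    rw [div_eq_inv_mul]
    refine mul_le_mul ?_ (hf y hy) (abs_nonneg _) hD0
    calc (dist x y ^ ((n : ℝ) - b))⁻¹ ≤ ((R * s / 2) ^ ((n : ℝ) - b))⁻¹ :=
          inv_anti₀ (by positivity) (Real.rpow_le_rpow (by positivity) (hdist y hy) (by linarith))
      _ = 2 ^ ((n : ℝ) - b) * (R * s) ^ (b - n) := by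
          rw [Real.div_rpow hr.le (by norm_num), inv_div, div_eq_mul_inv, ← Real.rpow_neg hr.le,
            neg_sub]
      _ ≤ D := by
          refine mul_le_mul_of_nonneg_right ?_ (by positivity)
          exact Real.rpow_le_rpow_of_exponent_le (by norm_num) (by linarith)
  have hθm : ∫⁻ y in A, ENNReal.ofReal (G y) ^ (b / n) ≤
      m ^ (b / n) * ENNReal.ofReal ((V * (R * s) ^ (n : ℝ)) ^ (1 - b / n)) := by
    refine (lintegral_rpow_le hGm hθ.le hθ1).trans ?_
    rw [Measure.restrict_apply_univ,
      ← ENNReal.ofReal_rpow_of_nonneg (by positivity) (by linarith)]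
    gcongr
  have hreal₁ : D * (V * (R * s) ^ (n : ℝ)) + D * s ^ (n : ℝ) ≤
      2 ^ (n : ℝ) * (V * R ^ (n : ℝ) + 1) * s ^ a := by
    have h1 : (R * s) ^ (b - n) * (R * s) ^ (n : ℝ) ≤ R ^ (n : ℝ) * s ^ a := by
      rw [← Real.rpow_add hr, sub_add_cancel, Real.mul_rpow hR0.le hs.le]
      exact mul_le_mul (Real.rpow_le_rpow_of_exponent_le hR hbn.le)
        (Real.rpow_le_rpow_of_exponent_ge hs hs1 hab) (by positivity) (by positivity)
    have h2 : (R * s) ^ (b - n) * s ^ (n : ℝ) ≤ s ^ a := by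
      rw [Real.mul_rpow hR0.le hs.le, mul_assoc, ← Real.rpow_add hs, sub_add_cancel]
      refine (mul_le_of_le_one_left (by positivity)
        (Real.rpow_le_one_of_one_le_of_nonpos hR (by linarith))).trans
        (Real.rpow_le_rpow_of_exponent_ge hs hs1 hab)
    calc D * (V * (R * s) ^ (n : ℝ)) + D * s ^ (n : ℝ)
        = 2 ^ (n : ℝ) * (V * ((R * s) ^ (b - n) * (R * s) ^ (n : ℝ)) +
            (R * s) ^ (b - n) * s ^ (n : ℝ)) := by rw [hD]; ring
      _ ≤ 2 ^ (n : ℝ) * (V * (R ^ (n : ℝ) * s ^ a) + s ^ a) := by gcongr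
      _ = _ := by ring
  have hreal₂ : D * (E * (V * (R * s) ^ (n : ℝ)) ^ (1 - b / n)) ≤
      2 ^ (n : ℝ) * E * (1 + V) := by
    have h1 : ((R * s) ^ (n : ℝ)) ^ (1 - b / n) = (R * s) ^ (n - b) := by
      rw [← Real.rpow_mul hr.le]
      congr 1
      field_simp
    have h2 : V ^ (1 - b / n) ≤ 1 + V := by
      calc V ^ (1 - b / n) ≤ (1 + V) ^ (1 - b / n) :=
            Real.rpow_le_rpow hV (by linarith) (by linarith)
        _ ≤ (1 + V) ^ (1 : ℝ) := Real.rpow_le_rpow_of_exponent_le (by linarith) (by linarith)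
        _ = 1 + V := Real.rpow_one _
    have h3 : (R * s) ^ (b - n) * (R * s) ^ (n - b) = 1 := by
      rw [← Real.rpow_add hr]; simp
    rw [Real.mul_rpow hV (by positivity), h1]
    calc D * (E * (V ^ (1 - b / n) * (R * s) ^ (n - b)))
        = 2 ^ (n : ℝ) * E * V ^ (1 - b / n) * ((R * s) ^ (b - n) * (R * s) ^ (n - b)) := by
          rw [hD]; ring
      _ ≤ _ := by rw [h3, mul_one]; gcongr
  calc ∫⁻ y in A, ENNReal.ofReal (|f y| / dist x y ^ ((n : ℝ) - b))
      ≤ ∫⁻ y in A, ENNReal.ofReal D * (1 + ENNReal.ofReal E * ENNReal.ofReal (G y) ^ (b / n) +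
          ENNReal.ofReal (s ^ (n : ℝ)) * ENNReal.ofReal (G y)) := setLIntegral_mono' hA hptw
    _ = ENNReal.ofReal D * (volume A +
          ENNReal.ofReal E * (∫⁻ y in A, ENNReal.ofReal (G y) ^ (b / n)) +
          ENNReal.ofReal (s ^ (n : ℝ)) * m) := by
        rw [lintegral_const_mul' _ _ ENNReal.ofReal_ne_top,
          lintegral_add_right' _ (hGm.const_mul _),
          lintegral_add_left' aemeasurable_const,
          lintegral_const_mul' _ _ ENNReal.ofReal_ne_top,
          lintegral_const_mul' _ _ ENNReal.ofReal_ne_top, setLIntegral_one]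
    _ ≤ ENNReal.ofReal D * (ENNReal.ofReal (V * (R * s) ^ (n : ℝ)) +
          ENNReal.ofReal E *
            (m ^ (b / n) * ENNReal.ofReal ((V * (R * s) ^ (n : ℝ)) ^ (1 - b / n))) +
          ENNReal.ofReal (s ^ (n : ℝ)) * 1) := by gcongr
    _ = ENNReal.ofReal (D * (V * (R * s) ^ (n : ℝ)) + D * s ^ (n : ℝ)) +
          ENNReal.ofReal (D * (E * (V * (R * s) ^ (n : ℝ)) ^ (1 - b / n))) * m ^ (b / n) := by
        rw [ENNReal.ofReal_add (by positivity) (by positivity), ENNReal.ofReal_mul hD0,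
          ENNReal.ofReal_mul hD0 (q := s ^ (n : ℝ)), ENNReal.ofReal_mul hD0 (q := E * _),
          ENNReal.ofReal_mul hE]
        ring
    _ ≤ _ := by gcongr

theorem LogHolderOn.exists_abs_sub_mul_neg_log_le {n : ℕ} {U : Set (Space n)} {g : Space n → ℝ}
    (h : LogHolderOn U g) {R : ℝ} (hR : 1 ≤ R) :
    ∃ L : ℝ, ∀ x ∈ U, ∀ y ∈ U, x ≠ y → ∀ s : ℝ, 0 < s → dist x y ≤ R * s →
      |g x - g y| * -Real.log s ≤ L := by
  obtain ⟨c, hc, h⟩ := h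
  have hlR : 0 ≤ Real.log R := Real.log_nonneg hR
  refine ⟨c * (1 + Real.log R), fun x hx y hy hxy s hs hd => ?_⟩
  rcases le_or_gt 0 (Real.log s) with hls | hls
  · exact (mul_nonpos_of_nonneg_of_nonpos (abs_nonneg _) (by linarith)).trans (by positivity)
  have hd0 : 0 < dist x y := dist_pos.2 hxy
  have hR0 : 0 < R := by linarith
  have hinv : 0 < 1 / dist x y := by positivity
  set D := Real.log (Real.exp 1 + 1 / dist x y) with hD
  have hD1 : 1 ≤ D := by
    rw [hD, Real.le_log_iff_exp_le (by positivity)]; linarith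
  have hsD : -Real.log s ≤ (1 + Real.log R) * D := by
    have h1 : Real.log (1 / (R * s)) ≤ D := by
      refine Real.log_le_log (by positivity) ?_
      have : 1 / (R * s) ≤ 1 / dist x y := one_div_le_one_div_of_le hd0 hd
      linarith [Real.exp_pos 1]
    rw [one_div, Real.log_inv, Real.log_mul hR0.ne' hs.ne'] at h1
    nlinarith
  calc |g x - g y| * -Real.log s ≤ c / D * ((1 + Real.log R) * D) :=
        mul_le_mul (h x hx y hy hxy) hsD (by linarith) (by positivity)
    _ = c * (1 + Real.log R) := by field_simp

theorem exists_annulus_bound {n : ℕ} (hn : 0 < n) {Ω : Set (Space n)} (hΩ : MeasurableSet Ω)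
    {α : Space n → ℝ} (hlog : LogHolderOn Ω α) {a B R : ℝ} (hR : 1 ≤ R) (ha : 0 < a) (hB : B < n)
    (hα : ∀ x ∈ Ω, a ≤ α x ∧ α x ≤ B) :
    ∃ C₁ C₂ : ℝ, 0 < C₁ ∧ 0 < C₂ ∧ ∀ f : Space n → ℝ,
      AEStronglyMeasurable f (volume.restrict Ω) → modular Ω (fun x => (n : ℝ) / α x) f ≤ 1 →
      ∀ x ∈ Ω, ∀ k,
        ∫⁻ y in dyadicAnnulus Ω x R k, ENNReal.ofReal (|f y| / dist x y ^ ((n : ℝ) - α x)) ≤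
          ENNReal.ofReal (C₁ * ((1 / 2 : ℝ) ^ a) ^ k) + ENNReal.ofReal C₂ *
            modularMeasure Ω (fun x => (n : ℝ) / α x) f (dyadicAnnulus Ω x R k) ^ (α x / n) := by
  obtain ⟨L, hlogL⟩ := hlog.exists_abs_sub_mul_neg_log_le hR
  have hn0 : (0 : ℝ) < n := by exact_mod_cast hn
  have hR0 : 0 < R := by linarith
  set V : ℝ := (volume (Metric.ball (0 : Space n) 1)).toReal with hV
  have hV0 : 0 ≤ V := ENNReal.toReal_nonneg
  -- Chosen so that `M * (1 - B / n) = n`, which makes the factor of the last term `s ^ n`.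
  set M : ℝ := n * n / (n - B) with hM
  have hnB : 0 < n - B := by linarith
  set E : ℝ := Real.exp (M * (L / n)) with hE
  have hE0 : 0 < E := Real.exp_pos _
  refine ⟨2 ^ (n : ℝ) * (V * R ^ (n : ℝ) + 1), 2 ^ (n : ℝ) * E * (1 + V), by positivity,
    by positivity, fun f hf hmod x hx k => ?_⟩
  have hAm := measurableSet_dyadicAnnulus (x := x) (R := R) hΩ k
  have hAsub := dyadicAnnulus_subset (U := Ω) (x := x) (R := R) k
  have hs : (0 : ℝ) < (1 / 2) ^ k := by positivity
  have hs1 : (1 / 2 : ℝ) ^ k ≤ 1 := pow_le_one₀ (by norm_num) (by norm_num)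
  rw [modularMeasure_apply _ _ hAm hAsub]
  have hpow : ((1 / 2 : ℝ) ^ a) ^ k = ((1 / 2 : ℝ) ^ k) ^ a := by
    rw [← Real.rpow_natCast, ← Real.rpow_natCast, ← Real.rpow_mul (by norm_num),
      ← Real.rpow_mul (by norm_num), mul_comm]
  rw [hpow]
  refine lintegral_div_dist_rpow_le hAm (fun y => Real.rpow_nonneg (abs_nonneg _) _) ?_ hR hs hs1
    hE0.le hV0 ha (hα x hx).1 ((hα x hx).2.trans_lt hB) ?_ ?_ ?_ ?_
  · have hαm : AEMeasurable α (volume.restrict Ω) := hlog.continuousOn.aemeasurable hΩ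
    refine AEMeasurable.mono_measure ?_ (Measure.restrict_mono_set _ hAsub)
    exact (((continuous_abs.measurable.comp_aemeasurable hf.aemeasurable).pow
      (hαm.const_div _))).ennreal_ofReal
  · refine (measure_mono (dyadicAnnulus_subset_closedBall k)).trans_eq ?_
    have : Nontrivial (Space n) := by
      have : Nonempty (Fin n) := ⟨⟨0, hn⟩⟩
      infer_instance
    rw [Measure.addHaar_closedBall _ _ (by positivity), mul_comm V,
      ENNReal.ofReal_mul (by positivity), hV,
      ENNReal.ofReal_toReal Metric.isBounded_ball.measure_lt_top.ne, finrank_euclideanSpace_fin, Real.rpow_natCast]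
  · intro y hy
    refine le_trans (le_of_eq ?_) hy.2.1.le
    rw [pow_succ]; ring
  · intro y hy
    have hyΩ := hAsub hy
    have hαy : 0 < α y := ha.trans_le (hα y hyΩ).1
    have hxy : x ≠ y := dist_pos.1 ((by positivity : 0 < R * (1 / 2) ^ (k + 1)).trans hy.2.1)
    have hfy : |f y| = (|f y| ^ (n / α y)) ^ (α y / n) := by
      rw [← Real.rpow_mul (abs_nonneg _), div_mul_div_cancel₀ hαy.ne', div_self hn0.ne',
        Real.rpow_one]
    have hαB := (hα y hyΩ).2
    nth_rewrite 1 [hfy]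
    refine rpow_le_one_add_add (Real.rpow_nonneg (abs_nonneg _) _) hs hs1 (by positivity)
      (by positivity) ((div_le_one hn0).2 (by linarith)) ?_ ?_
    · calc (n : ℝ) = M * (1 - B / n) := by rw [hM]; field_simp
        _ ≤ M * (1 - α y / n) := by gcongr
    · rw [← sub_div, abs_div, abs_of_pos hn0, div_mul_eq_mul_div]
      refine div_le_div_of_nonneg_right ?_ hn0.le
      rw [abs_sub_comm]
      exact hlogL x hx y hyΩ hxy _ hs hy.2.2
  · rw [← modularMeasure_apply _ _ hAm hAsub]
    refine (measure_mono (Set.subset_univ _)).trans ?_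
    rwa [modularMeasure_univ]

/-! ### From a large potential to a heavy ball -/

/-- Every point where the potential exceeds `t` is the centre of a ball whose contribution to the
content is at most `C exp(-κ t ^ (n / (n - a)))` times the modular of `f` over the ball. -/
theorem exists_radius_of_lt_rieszPotential {n : ℕ} (hn : 0 < n) {Ω : Set (Space n)}
    (hΩ : MeasurableSet Ω) {α : Space n → ℝ} (hlog : LogHolderOn Ω α) {a B R : ℝ} (hR : 1 ≤ R)
    (hΩR : ∀ x ∈ Ω, ∀ y ∈ Ω, dist x y ≤ R) (ha : 0 < a) (hB : B < n)
    (hα : ∀ x ∈ Ω, a ≤ α x ∧ α x ≤ B) :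
    ∃ t₀ C κ : ℝ, 0 < C ∧ 0 < κ ∧ ∀ f : Space n → ℝ,
      AEStronglyMeasurable f (volume.restrict Ω) → modular Ω (fun x => (n : ℝ) / α x) f ≤ 1 →
      ∀ t : ℝ, t₀ ≤ t → ∀ x ∈ Ω, ENNReal.ofReal t < rieszPotential Ω α f x →
        ∃ r : ℝ, 0 < r ∧ r ≤ R ∧ ENNReal.ofReal (r ^ ((n : ℝ) - α x)) ≤
          ENNReal.ofReal (C * Real.exp (-κ * t ^ ((n : ℝ) / (n - a)))) *
            modularMeasure Ω (fun x => (n : ℝ) / α x) f (Metric.closedBall x r) := by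
  obtain ⟨C₁, C₂, hC₁, hC₂, hbound⟩ := exists_annulus_bound hn hΩ hlog hR ha hB hα
  have hn0 : (0 : ℝ) < n := by exact_mod_cast hn
  have hR0 : 0 < R := by linarith
  have hnB : 0 < n - B := by linarith
  set q : ℝ := (1 / 2) ^ a with hq
  have hq0 : 0 ≤ q := by positivity
  have hq1 : q < 1 := Real.rpow_lt_one (by norm_num) (by norm_num) ha
  -- The slowest decay of `2^{-k(n - α x)}` allowed by `α ≤ B`.
  set ρ : ℝ := (1 / 2) ^ (n - B) with hρ
  have hρ0 : 0 < ρ := by positivity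
  have hρ1 : ρ < 1 := Real.rpow_lt_one (by norm_num) (by norm_num) hnB
  set P : ℝ := n / (n - a) with hP
  set κ : ℝ := -Real.log ρ * (2 * C₂)⁻¹ ^ P with hκ
  have hlρ : Real.log ρ < 0 := Real.log_neg hρ0 hρ1
  -- The first threshold gives `τ ≥ 1`; the second makes the geometric sums at most `t / 2`. The
  -- factor `ρ⁻¹` pays for rounding `K` down, and `κ` is defined by `ρ ^ (τ ^ P) = exp (-κ t ^ P)`.
  refine ⟨max (2 * C₂) (2 * (C₁ / (1 - q) + C₂ / (1 - ρ ^ (a / n)))), R ^ (n : ℝ) * ρ⁻¹, κ,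
    by positivity, mul_pos (by linarith) (by positivity), fun f hf hmod t ht x hx htx => ?_⟩
  have ht1 : 2 * C₂ ≤ t := (le_max_left _ _).trans ht
  have ht2 := (le_max_right _ _).trans ht
  have ht0 : 0 < t := by linarith
  obtain ⟨hax, hxB⟩ := hα x hx
  have hnαx : 0 < n - α x := by linarith
  have hθ1 : 0 < 1 - α x / n := by rw [sub_pos, div_lt_one hn0]; linarith
  set τ : ℝ := t / (2 * C₂) with hτ
  have hτ1 : 1 ≤ τ := (one_le_div (by positivity)).2 ht1
  -- The largest `K` with `C₂ * K ^ (1 - α x / n) ≤ t / 2`.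
  set K : ℕ := ⌊τ ^ (1 - α x / n)⁻¹⌋₊ with hK
  have hKle : C₂ * (K : ℝ) ^ (1 - α x / n) ≤ t / 2 := by
    have h1 : (K : ℝ) ^ (1 - α x / n) ≤ τ := by
      calc (K : ℝ) ^ (1 - α x / n) ≤ (τ ^ (1 - α x / n)⁻¹) ^ (1 - α x / n) :=
            Real.rpow_le_rpow (by positivity) (Nat.floor_le (by positivity)) hθ1.le
        _ = τ := Real.rpow_inv_rpow (by positivity) hθ1.ne'
    calc C₂ * (K : ℝ) ^ (1 - α x / n) ≤ C₂ * τ := by gcongr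
      _ = t / 2 := by rw [hτ]; field_simp
  -- The exponent `n / (n - α x)` is at least `P` because `α x ≥ a`; with `τ ≥ 1` the bound becomes
  -- uniform in `x`.
  have hKge : τ ^ P - 1 ≤ K := by
    have h1 : τ ^ P ≤ τ ^ (1 - α x / n)⁻¹ := by
      refine Real.rpow_le_rpow_of_exponent_le hτ1 ?_
      have : (1 - α x / n)⁻¹ = n / (n - α x) := by field_simp
      rw [this, hP]
      gcongr
    linarith [Nat.lt_floor_add_one (τ ^ (1 - α x / n)⁻¹)]
  set μ := modularMeasure Ω (fun x => (n : ℝ) / α x) f with hμ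
  have hμsum : ∑' k, μ (dyadicAnnulus Ω x R k) ≤ 1 := by
    refine (tsum_meas_le_meas_iUnion_of_disjoint μ
      (fun k => measurableSet_dyadicAnnulus hΩ k) (pairwise_disjoint_dyadicAnnulus hR0.le)).trans
      ((measure_mono (Set.subset_univ _)).trans ?_)
    rwa [hμ, modularMeasure_univ]
  obtain ⟨k, hk⟩ := exists_pow_le_of_lt_tsum (K := K) hμsum hC₁.le hC₂.le hq0 hq1 hρ0 hρ1
    (by positivity : 0 < a / n) (by gcongr : a / n ≤ α x / n) (by linarith)
    (fun k => hbound f hf hmod x hx k) (by linarith) hKle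
    (htx.trans_le (rieszPotential_le_tsum hR0 (hΩR x hx) (by linarith)))
  refine ⟨R * (1 / 2) ^ (k + K), by positivity,
    mul_le_of_le_one_right hR0.le (pow_le_one₀ (by norm_num) (by norm_num)), ?_⟩
  have hmain : (R * (1 / 2) ^ (k + K)) ^ ((n : ℝ) - α x) ≤
      R ^ (n : ℝ) * ρ⁻¹ * Real.exp (-κ * t ^ P) * ρ ^ k := by
    have h1 : R ^ ((n : ℝ) - α x) ≤ R ^ (n : ℝ) :=
      Real.rpow_le_rpow_of_exponent_le hR (by linarith)
    have h2 : ((1 / 2 : ℝ) ^ (k + K)) ^ ((n : ℝ) - α x) ≤ ρ ^ (k + K) := by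
      rw [hρ, ← Real.rpow_natCast, ← Real.rpow_natCast, ← Real.rpow_mul (by norm_num),
        ← Real.rpow_mul (by norm_num), mul_comm]
      exact Real.rpow_le_rpow_of_exponent_ge (by norm_num) (by norm_num) (by gcongr)
    have h3 : ρ ^ K ≤ ρ⁻¹ * Real.exp (-κ * t ^ P) := by
      calc ρ ^ K = ρ ^ (K : ℝ) := (Real.rpow_natCast _ _).symm
        _ ≤ ρ ^ (τ ^ P - 1) := Real.rpow_le_rpow_of_exponent_ge hρ0 hρ1.le hKge
        _ = ρ⁻¹ * Real.exp (-κ * t ^ P) := by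
            rw [Real.rpow_sub hρ0, Real.rpow_one, div_eq_inv_mul, Real.rpow_def_of_pos hρ0, hκ, hτ,
              div_eq_inv_mul, Real.mul_rpow (by positivity) ht0.le]
            congr 2
            ring
    calc (R * (1 / 2) ^ (k + K)) ^ ((n : ℝ) - α x)
        = R ^ ((n : ℝ) - α x) * ((1 / 2 : ℝ) ^ (k + K)) ^ ((n : ℝ) - α x) :=
          Real.mul_rpow hR0.le (by positivity)
      _ ≤ R ^ (n : ℝ) * ρ ^ (k + K) := by gcongr
      _ = R ^ (n : ℝ) * ρ ^ K * ρ ^ k := by rw [pow_add]; ring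
      _ ≤ R ^ (n : ℝ) * (ρ⁻¹ * Real.exp (-κ * t ^ P)) * ρ ^ k := by gcongr
      _ = _ := by ring
  calc ENNReal.ofReal ((R * (1 / 2) ^ (k + K)) ^ ((n : ℝ) - α x))
      ≤ ENNReal.ofReal (R ^ (n : ℝ) * ρ⁻¹ * Real.exp (-κ * t ^ P)) * ENNReal.ofReal (ρ ^ k) := by
        rw [← ENNReal.ofReal_mul (by positivity)]
        exact ENNReal.ofReal_le_ofReal hmain
    _ ≤ _ := by
        gcongr
        exact hk.trans (measure_mono (dyadicAnnulus_subset_closedBall _))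

end VarRiesz

/-! ### Conclusion -/

theorem theorem1p1 (n : ℕ) (hn : 2 ≤ n) (Ω : Set (VarRiesz.Space n)) (hopen : IsOpen Ω)
    (hbdd : Bornology.IsBounded Ω) (α : VarRiesz.Space n → ℝ)
    (hrange : ∀ x ∈ Ω, 0 ≤ α x ∧ α x < n)
    (hlog : VarRiesz.LogHolderOn Ω α)
    (hinf : 0 < VarRiesz.essInfOn Ω α)
    (hsup : VarRiesz.essSupOn Ω α < n) :
    ∃ c₁ c₂ : ℝ, 0 < c₁ ∧ 0 < c₂ ∧
      ∀ f : VarRiesz.Space n → ℝ,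
        VarRiesz.MemVarLp Ω (fun x => (n : ℝ) / α x) f →
        VarRiesz.luxemburgNorm Ω (fun x => (n : ℝ) / α x) f
          ≤ 1 / (2 * (1 + (MeasureTheory.volume Ω).toReal)) →
        ∀ t : ℝ, 0 ≤ t →
          VarRiesz.hausdorffContent Ω (fun x => (n : ℝ) - α x)
              {x | x ∈ Ω ∧ ENNReal.ofReal t < VarRiesz.rieszPotential Ω α f x}
            ≤ ENNReal.ofReal
                (c₁ * Real.exp (-c₂ * t ^ ((n : ℝ) / ((n : ℝ) - VarRiesz.essInfOn Ω α)))) := by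
  have hcont := hlog.continuousOn
  have hα : ∀ x ∈ Ω, VarRiesz.essInfOn Ω α ≤ α x ∧ α x ≤ VarRiesz.essSupOn Ω α := fun x hx =>
    ⟨VarRiesz.essInfOn_le hopen hcont (fun y hy => (hrange y hy).1) x hx,
      VarRiesz.le_essSupOn hopen hcont (fun y hy => (hrange y hy).2.le) x hx⟩
  obtain ⟨x₀, hx₀⟩ : Ω.Nonempty := by
    by_contra hne
    rw [Set.not_nonempty_iff_eq_empty.1 hne, VarRiesz.essInfOn_empty] at hinf
    exact lt_irrefl _ hinf
  obtain ⟨R₀, hR₀⟩ := Metric.isBounded_iff.1 hbdd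
  set R : ℝ := max R₀ 1 with hRdef
  have hR : 1 ≤ R := le_max_right _ _
  have hΩR : ∀ x ∈ Ω, ∀ y ∈ Ω, dist x y ≤ R := fun x hx y hy =>
    (hR₀ hx hy).trans (le_max_left _ _)
  obtain ⟨t₀, C, κ, hC, hκ, hball⟩ := VarRiesz.exists_radius_of_lt_rieszPotential (by omega)
    hopen.measurableSet hlog hR hΩR hinf hsup hα
  have hβ : 0 < (n : ℝ) - α x₀ := sub_pos.2 (hrange x₀ hx₀).2
  set P : ℝ := (n : ℝ) / ((n : ℝ) - VarRiesz.essInfOn Ω α) with hP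
  have hP0 : 0 ≤ P := div_nonneg (by positivity) (by linarith [(hα x₀ hx₀).1])
  -- The first summand of `c₁` serves `t ≥ t₀`. The second serves `t < t₀`, where the ball of radius
  -- `R + 1` about `x₀` covers `Ω` and `exp (κ t₀ ^ P)` offsets the decay.
  refine ⟨6 ^ n * C + (R + 1) ^ ((n : ℝ) - α x₀) * Real.exp (κ * t₀ ^ P), κ, by positivity, hκ,
    fun f hf hnorm t ht => ?_⟩
  have hmod : VarRiesz.modular Ω (fun x => (n : ℝ) / α x) f ≤ 1 := by
    refine VarRiesz.modular_le_one hopen.measurableSet (fun x hx => ?_) hf.2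
      (hnorm.trans_lt ?_)
    · exact (one_le_div (hinf.trans_le (hα x hx).1)).2 (hrange x hx).2.le
    · have : 0 ≤ (volume Ω).toReal := ENNReal.toReal_nonneg
      rw [div_lt_one (by positivity)]
      linarith
  rcases le_or_gt t₀ t with htt | htt
  · refine (VarRiesz.hausdorffContent_le_of_forall_closedBall hx₀ hβ (fun x hx => hx.1)
      (fun x hx => sub_le_self _ (hrange x hx).1)
      (VarRiesz.modularMeasure Ω (fun x => (n : ℝ) / α x) f)
      (fun x hx => hball f hf.1 hmod t htt x hx.1 hx.2)).trans ?_
    rw [VarRiesz.modularMeasure_univ]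
    calc (6 : ENNReal) ^ n * (ENNReal.ofReal (C * Real.exp (-κ * t ^ P)) *
          VarRiesz.modular Ω (fun x => (n : ℝ) / α x) f)
        ≤ 6 ^ n * (ENNReal.ofReal (C * Real.exp (-κ * t ^ P)) * 1) := by gcongr
      _ = ENNReal.ofReal (6 ^ n * (C * Real.exp (-κ * t ^ P))) := by
          rw [mul_one, ENNReal.ofReal_mul (p := 6 ^ n) (by positivity),
            ENNReal.ofReal_pow (by norm_num)]
          norm_num
      _ ≤ _ := by
          refine ENNReal.ofReal_le_ofReal ?_
          rw [← mul_assoc]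
          gcongr
          exact le_add_of_nonneg_right (by positivity)
  · refine (VarRiesz.hausdorffContent_le_tsum hx₀ hβ (fun _ : Unit => x₀) (fun _ => R + 1)
      (fun _ => hx₀) (fun _ => by positivity) fun x hx => ?_).trans ?_
    · exact Set.mem_iUnion.2 ⟨(), Metric.mem_ball.2 ((hΩR x hx.1 x₀ hx₀).trans_lt (by linarith))⟩
    · rw [tsum_fintype, Finset.univ_unique, Finset.sum_singleton]
      refine ENNReal.ofReal_le_ofReal ?_
      have h1 : t ^ P ≤ t₀ ^ P := Real.rpow_le_rpow ht htt.le hP0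
      have h2 : 1 ≤ Real.exp (κ * t₀ ^ P) * Real.exp (-κ * t ^ P) := by
        rw [← Real.exp_add, Real.one_le_exp_iff]
        nlinarith
      calc (R + 1) ^ ((n : ℝ) - α x₀)
          ≤ (R + 1) ^ ((n : ℝ) - α x₀) * (Real.exp (κ * t₀ ^ P) * Real.exp (-κ * t ^ P)) :=
            le_mul_of_one_le_right (by positivity) h2
        _ ≤ _ := by
            rw [add_mul, mul_assoc _ (Real.exp (κ * t₀ ^ P))]
            exact le_add_of_nonneg_left (by positivity)
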